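/- Let $0<q<1$ and let $C(SU_q(2))$ be the universal unital C*-algebra generated by $\alpha,\gamma$ subject to $$\alpha\gamma=q\gamma\alpha,\quad \alpha\gamma^*=q\gamma^*\alpha,\quad \gamma\gamma^*=\gamma^*\gamma,\quad \alpha^*\alpha+\gamma^*\gamma=1,\quad \alpha\alpha^*+q^2\gamma\gamma^*=1.$$ Let $$U=\begin{pmatrix}\alpha&-q\gamma^*\\ \gamma&\alpha^*\end{pmatrix}\in U_2\big(C(SU_q(2))\big),\qquad \tilde w=1+(\gamma-1)\big(1-\alpha^*(\alpha\alpha^*)^{-1}\alpha\big)\in U_1\big(C(SU_q(2))\big)$$ be the fundamental representation of $SU_q(2)$ and Masuda's unitary; here $\alpha\alpha^*$ is invertible, and $U$ and $\tilde w$ are unitary. Then $$[U]=[\tilde w]\quad\text{in } K_1\big(C(SU_q(2))\big),$$ where, for a unital C*-algebra $A$, $K_1(A)=U_\infty(A)/U_\infty(A)_0$ is the quotient of the stable unitary group $U_\infty(A)=\varinjlim_n U_n(A)$ (along $u\mapsto\mathrm{diag}(u,1)$) by the subgroup of classes of unitaries that are connected to $1$ by a norm-continuous path of unitaries in some $U_n(A)$.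 -/

import Mathlib

open scoped ENNReal

noncomputable section

/-! ### The group `K₁` of a unital C⋆-algebra -/

section KOne

variable (A : Type*) [CStarAlgebra A]

/-- The unitary group `U_n(A)` of the C⋆-algebra of `n × n` matrices over `A`. It carries the
topology of entrywise norm convergence, which is the topology of the C⋆-norm on matrices. -/
abbrev UnitaryMatrix (n : ℕ) : Type _ := unitary (Matrix (Fin n) (Fin n) A)

variable {A}

/-- The block matrix `diag(u, 1)` of size `m`, for a matrix `u` of size `n ≤ m`. -/
def padMatrix (n m : ℕ) (u : Matrix (Fin n) (Fin n) A) : Matrix (Fin m) (Fin m) A :=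
  Matrix.of fun i j =>
    if h : (i : ℕ) < n ∧ (j : ℕ) < n then u ⟨i, h.1⟩ ⟨j, h.2⟩ else if i = j then 1 else 0

theorem padMatrix_apply (n m : ℕ) (u : Matrix (Fin n) (Fin n) A) (i j : Fin m) :
    padMatrix n m u i j =
      if h : (i : ℕ) < n ∧ (j : ℕ) < n then u ⟨i, h.1⟩ ⟨j, h.2⟩ else if i = j then 1 else 0 :=
  rfl

theorem padMatrix_one (n m : ℕ) : padMatrix n m (1 : Matrix (Fin n) (Fin n) A) = 1 := by
  ext i j
  simp only [padMatrix_apply, Matrix.one_apply, Fin.ext_iff]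
  split_ifs <;> rfl

theorem padMatrix_mul {n m : ℕ} (h : n ≤ m) (u v : Matrix (Fin n) (Fin n) A) :
    padMatrix n m (u * v) = padMatrix n m u * padMatrix n m v := by
  obtain ⟨k, rfl⟩ := Nat.exists_eq_add_of_le h
  have e1 : ∀ (x : Fin n) (y : ℕ), (x : ℕ) ≠ n + y := fun x y => by omega
  have e2 : ∀ (x : Fin n) (y : ℕ), n + y ≠ (x : ℕ) := fun x y => by omega
  ext i j
  rw [Matrix.mul_apply, Fin.sum_univ_add]
  induction i using Fin.addCases <;> induction j using Fin.addCases <;>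
    simp [padMatrix_apply, Matrix.mul_apply, Fin.ext_iff, e1, e2]
  simp [← Fin.ext_iff]

theorem padMatrix_star (n m : ℕ) (u : Matrix (Fin n) (Fin n) A) :
    padMatrix n m (star u) = star (padMatrix n m u) := by
  ext i j
  simp only [padMatrix_apply, Matrix.star_apply]
  by_cases h : (i : ℕ) < n ∧ (j : ℕ) < n
  · simp [h]
  · have h' : ¬ ((j : ℕ) < n ∧ (i : ℕ) < n) := fun h' => h h'.symm
    simp only [h, h', dite_false, eq_comm (a := i)]
    split_ifs <;> simp

theorem padMatrix_self (n : ℕ) (u : Matrix (Fin n) (Fin n) A) : padMatrix n n u = u := by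
  ext i j
  simp [padMatrix_apply]

theorem padMatrix_padMatrix {n m k : ℕ} (h : n ≤ m) (u : Matrix (Fin n) (Fin n) A) :
    padMatrix m k (padMatrix n m u) = padMatrix n k u := by
  ext i j
  simp only [padMatrix_apply, Fin.ext_iff]
  split_ifs <;> first | rfl | omega

theorem continuous_padMatrix (n m : ℕ) :
    Continuous (padMatrix n m : Matrix (Fin n) (Fin n) A → _) := by
  refine continuous_pi fun i => continuous_pi fun j => ?_
  simp only [padMatrix_apply]
  split_ifs
  · exact (continuous_apply _).comp (continuous_apply _)
  all_goals exact continuous_const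

/-- The stabilization homomorphism `U_n(A) → U_m(A)`, `u ↦ diag(u, 1)`, for `n ≤ m`. -/
def UnitaryMatrix.pad (n m : ℕ) (h : n ≤ m) : UnitaryMatrix A n →* UnitaryMatrix A m where
  toFun u := ⟨padMatrix n m u, by
    rw [Unitary.mem_iff, ← padMatrix_star, ← padMatrix_mul h, ← padMatrix_mul h,
      Unitary.star_mul_self_of_mem u.2, Unitary.mul_star_self_of_mem u.2, padMatrix_one]
    exact ⟨rfl, rfl⟩⟩
  map_one' := Subtype.ext (padMatrix_one n m)
  map_mul' u v := Subtype.ext (padMatrix_mul h u.1 v.1)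

theorem UnitaryMatrix.continuous_pad (n m : ℕ) (h : n ≤ m) :
    Continuous (UnitaryMatrix.pad (A := A) n m h) :=
  ((continuous_padMatrix n m).comp continuous_subtype_val).subtype_mk _

instance UnitaryMatrix.directedSystem :
    DirectedSystem (UnitaryMatrix A) (fun n m h => UnitaryMatrix.pad n m h) where
  map_self n u := Subtype.ext (padMatrix_self n u.1)
  map_map _ _ _ hij _ u := Subtype.ext (padMatrix_padMatrix hij u.1)

variable (A)

/-- The stable unitary group `U_∞(A)`, the direct limit of the groups `U_n(A)` along the
stabilization homomorphisms `u ↦ diag(u, 1)`. -/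
abbrev StableUnitary : Type _ := DirectLimit (UnitaryMatrix A) UnitaryMatrix.pad

/-- The subgroup of those classes in `U_∞(A)` that are represented, for some `n`, by a unitary
in `U_n(A)` which is joined to `1` by a norm-continuous path in `U_n(A)`. -/
def StableUnitary.identityComponent : Subgroup (StableUnitary A) where
  carrier := {x | ∃ (n : ℕ) (u : UnitaryMatrix A n), Joined 1 u ∧ x = ⟦⟨n, u⟩⟧}
  one_mem' := ⟨0, 1, Joined.refl _, DirectLimit.one_def 0⟩
  mul_mem' := by
    rintro _ _ ⟨n, u, hu, rfl⟩ ⟨m, v, hv, rfl⟩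
    refine ⟨max n m, UnitaryMatrix.pad _ _ (le_max_left n m) u *
      UnitaryMatrix.pad _ _ (le_max_right n m) v, ?_, ?_⟩
    · have h1 := hu.map (UnitaryMatrix.continuous_pad _ _ (le_max_left n m))
      have h2 := hv.map (UnitaryMatrix.continuous_pad _ _ (le_max_right n m))
      simpa using h1.mul h2
    · rw [← DirectLimit.mul_def, DirectLimit.mk_apply, DirectLimit.mk_apply]
  inv_mem' := by
    rintro _ ⟨n, u, hu, rfl⟩
    exact ⟨n, u⁻¹, by simpa using hu.inv, rfl⟩

instance StableUnitary.identityComponent_normal : (StableUnitary.identityComponent A).Normal where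
  conj_mem := by
    rintro _ ⟨n, u, hu, rfl⟩ g
    obtain ⟨m, v, rfl⟩ := DirectLimit.exists_eq_mk _ g
    refine ⟨max n m, UnitaryMatrix.pad _ _ (le_max_right n m) v *
      UnitaryMatrix.pad _ _ (le_max_left n m) u *
      (UnitaryMatrix.pad _ _ (le_max_right n m) v)⁻¹, ?_, ?_⟩
    · have h1 := hu.map (UnitaryMatrix.continuous_pad _ _ (le_max_left n m))
      have h2 := Joined.refl (UnitaryMatrix.pad (A := A) _ _ (le_max_right n m) v)
      simpa using (h2.mul h1).mul h2.inv
    · rw [← DirectLimit.mul_def, ← DirectLimit.mul_def, ← DirectLimit.inv_def,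
        DirectLimit.mk_apply, DirectLimit.mk_apply]

/-- The group `K₁(A) = U_∞(A) / U_∞(A)₀` of a unital C⋆-algebra `A`, written multiplicatively:
`[u]` and `[v]` agree if and only if `diag(u, 1)` and `diag(v, 1)` are joined by a continuous path
of unitaries in some `U_k(A)`. -/
abbrev KOne : Type _ := StableUnitary A ⧸ StableUnitary.identityComponent A

variable {A}

/-- The class `[u] ∈ K₁(A)` of a unitary matrix `u ∈ U_n(A)`. -/
def KOne.mk {n : ℕ} (u : UnitaryMatrix A n) : KOne A :=
  QuotientGroup.mk (⟦⟨n, u⟩⟧ : StableUnitary A)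

/-- A unitary element of `A`, viewed as a unitary `1 × 1` matrix. -/
def UnitaryMatrix.ofUnitary (u : unitary A) : UnitaryMatrix A 1 :=
  ⟨Matrix.of fun _ _ => (u : A), by
    constructor <;> ext i j <;>
      simp [Matrix.mul_apply, Matrix.star_apply, Matrix.one_apply, Subsingleton.elim i j]⟩

end KOne

/-! ### The C⋆-algebra `C(SU_q(2))` -/

/-- The defining relations of `C(SU_q(2))`, for elements `a` (in the role of `α`) and `c` (in the
role of `γ`) of a unital C⋆-algebra. -/
structure SUq2Relations (q : ℝ) {A : Type*} [CStarAlgebra A] (a c : A) : Prop where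
  mul_comm_q : a * c = (q : ℂ) • (c * a)
  mul_star_comm_q : a * star c = (q : ℂ) • (star c * a)
  normal : c * star c = star c * c
  star_mul_add : star a * a + star c * c = 1
  mul_star_add : a * star a + (q : ℂ) ^ 2 • (c * star c) = 1

section Relations

variable {q : ℝ} {A : Type*} [CStarAlgebra A] {a c : A}

/-- If `x⋆x + y⋆y = 1` then `‖x‖ ≤ 1`. -/
theorem norm_le_one_of_star_mul_add {x y : A} (h : star x * x + star y * y = 1) : ‖x‖ ≤ 1 := by
  let := CStarAlgebra.spectralOrder A
  have := CStarAlgebra.spectralOrderedRing A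
  have h1 : star x * x ≤ 1 := by
    rw [← h]
    exact le_add_of_nonneg_right (star_mul_self_nonneg y)
  have h2 : ‖star x * x‖ ≤ 1 :=
    (CStarAlgebra.norm_le_one_iff_of_nonneg _ (star_mul_self_nonneg x)).2 h1
  rw [CStarRing.norm_star_mul_self] at h2
  nlinarith [norm_nonneg x]

theorem SUq2Relations.norm_left_le (h : SUq2Relations q a c) : ‖a‖ ≤ 1 :=
  norm_le_one_of_star_mul_add h.star_mul_add

theorem SUq2Relations.norm_right_le (h : SUq2Relations q a c) : ‖c‖ ≤ 1 :=
  norm_le_one_of_star_mul_add (y := a) (by rw [add_comm, h.star_mul_add])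

theorem SUq2Relations.matrix_mem_unitary (h : SUq2Relations q a c) :
    (!![a, -((q : ℂ) • star c); c, star a] : Matrix (Fin 2) (Fin 2) A) ∈ unitary _ := by
  have h1 := h.mul_star_add
  have h2 := h.star_mul_add
  have h3 := congrArg star h.mul_star_comm_q
  have h4 := congrArg star h.mul_comm_q
  have h5 := h.mul_star_comm_q
  have h6 := h.normal
  have h7 := h.mul_comm_q
  simp only [star_mul, star_star, star_smul, Complex.star_def, Complex.conj_ofReal] at h3 h4
  rw [← Complex.ofReal_pow, Complex.coe_smul] at h1
  constructor <;> ext i j <;> fin_cases i <;> fin_cases j <;>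
    simp [Matrix.mul_apply, Matrix.star_apply, Fin.sum_univ_two, smul_smul, ← pow_two,
      h3, h4, h5, h7]
  · exact h2
  · rw [add_comm]; exact h1
  · rw [← h6]; exact h1
  · rw [h6, add_comm]; exact h2

theorem SUq2Relations.isUnit_mul_star (h : SUq2Relations q a c) (h0 : 0 < q) (h1 : q < 1) :
    IsUnit (a * star a) := by
  have h2 : a * star a = 1 - (q : ℂ) ^ 2 • (c * star c) := eq_sub_of_add_eq h.mul_star_add
  rw [h2]
  apply isUnit_one_sub_of_norm_lt_one
  rw [norm_smul, CStarRing.norm_self_mul_star, norm_pow, Complex.norm_real, Real.norm_eq_abs,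
    abs_of_pos h0]
  have h3 : ‖c‖ * ‖c‖ ≤ 1 := mul_le_one₀ h.norm_right_le (norm_nonneg c) h.norm_right_le
  nlinarith [mul_nonneg (norm_nonneg c) (norm_nonneg c)]

theorem SUq2Relations.masuda_mem_unitary (h : SUq2Relations q a c) {y : A}
    (hay : a * star a * y = 1) : 1 + (c - 1) * (1 - star a * y * a) ∈ unitary A := by
  have hys : star y = y := by
    have h3 : star y * (a * star a) = 1 := by
      simpa [mul_assoc] using congrArg star hay
    calc star y = star y * (a * star a * y) := by rw [hay, mul_one]
      _ = star y * (a * star a) * y := by noncomm_ring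
      _ = y := by rw [h3, one_mul]
  obtain ⟨p, hp⟩ : ∃ p : A, p = 1 - star a * y * a := ⟨_, rfl⟩
  have hap : a * p = 0 := by
    rw [hp, mul_sub, mul_one, ← mul_assoc, ← mul_assoc, hay, one_mul, sub_self]
  have hps : star p = p := by
    simp [hp, hys, mul_assoc]
  have hpa : p * star a = 0 := by
    simpa [hps] using congrArg star hap
  have key : ∀ x, a * x = 0 → p * x = x := fun x hx => by
    rw [hp, sub_mul, one_mul, mul_assoc, hx, mul_zero, sub_zero]
  have hpp : p * p = p := key p hap
  have hcp : p * (c * p) = c * p := key _ (by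
    rw [← mul_assoc, h.mul_comm_q, smul_mul_assoc, mul_assoc, hap, mul_zero, smul_zero])
  have hcp' : p * (star c * p) = star c * p := key _ (by
    rw [← mul_assoc, h.mul_star_comm_q, smul_mul_assoc, mul_assoc, hap, mul_zero, smul_zero])
  have hcomm : p * c = c * p := by
    have := congrArg star hcp'
    simp only [star_mul, star_star, hps] at this
    rw [← this, mul_assoc, hcp]
  have hcomm' : star c * p = p * star c := by
    simpa [hps] using congrArg star hcomm
  have hcc : star c * c * p = p := by
    have : star c * c = 1 - star a * a := eq_sub_of_add_eq' h.star_mul_add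
    rw [this, sub_mul, one_mul, mul_assoc, hap, mul_zero, sub_zero]
  have hws : star (1 + (c - 1) * p) = 1 + (star c - 1) * p := by
    simp only [star_add, star_mul, star_sub, star_one, hps]
    rw [mul_sub, sub_mul, hcomm', mul_one, one_mul]
  have hmul : ∀ x z : A, p * z = z * p → x * z * p = p →
      (1 + (x - 1) * p) * (1 + (z - 1) * p) = 1 := fun x z hz hxz => by
    have e : (1 + (x - 1) * p) * (1 + (z - 1) * p)
        = 1 + (x - 1) * p + (z - 1) * p + (x - 1) * (p * z) * p - (x - 1) * (p * p) := by
      noncomm_ring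
    rw [e, hz, mul_assoc _ (z * p) p, mul_assoc z p p, hpp]
    have e2 : 1 + (x - 1) * p + (z - 1) * p + (x - 1) * (z * p) - (x - 1) * p
        = 1 + (x * z * p - p) := by noncomm_ring
    rw [e2, hxz, sub_self, add_zero]
  rw [Unitary.mem_iff, ← hp, hws]
  exact ⟨hmul _ _ hcomm hcc, hmul _ _ hcomm'.symm (by rw [h.normal, hcc])⟩

end Relations

/-- Every C⋆-algebra with a small underlying type has an isomorphic copy in `Type`. -/
theorem exists_starAlgEquiv_of_small.{u} (D : Type u) [CStarAlgebra D] [Small.{0} D] :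
    ∃ (T : Type) (_ : CStarAlgebra T), Nonempty (T ≃⋆ₐ[ℂ] D) := by
  let e : Shrink.{0} D ≃ D := (equivShrink D).symm
  let i1 : Ring (Shrink.{0} D) := e.ring
  let i2 : Algebra ℂ (Shrink.{0} D) := e.algebra ℂ
  let i3 : StarRing (Shrink.{0} D) :=
    { star := fun x => e.symm (star (e x))
      star_involutive := fun x => by simp
      star_mul := fun x y => by
        apply e.injective
        change e (e.symm (star (e (e.symm (e x * e y))))) = e (e.symm (e (e.symm _) * e (e.symm _)))
        simp
      star_add := fun x y => by
        apply e.injective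
        change e (e.symm (star (e (e.symm (e x + e y))))) = e (e.symm (e (e.symm _) + e (e.symm _)))
        simp }
  let f : Shrink.{0} D ≃⋆ₐ[ℂ] D :=
    { e with
      map_mul' := fun x y => e.apply_symm_apply _
      map_add' := fun x y => e.apply_symm_apply _
      map_smul' := fun r x => e.apply_symm_apply _
      map_star' := fun x => e.apply_symm_apply _ }
  let i4 : NormedRing (Shrink.{0} D) :=
    NormedRing.induced (Shrink.{0} D) D (f : Shrink.{0} D →⋆ₐ[ℂ] D) e.injective
  let i5 : NormedAlgebra ℂ (Shrink.{0} D) :=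
    NormedAlgebra.induced ℂ (Shrink.{0} D) D (f : Shrink.{0} D →⋆ₐ[ℂ] D)
  have hf : Isometry e := AddMonoidHomClass.isometry_of_norm (f : Shrink.{0} D →⋆ₐ[ℂ] D) fun _ => rfl
  have i6 : CStarRing (Shrink.{0} D) := ⟨fun x => by
    change ‖e x‖ * ‖e x‖ ≤ ‖f (star x * x)‖
    rw [map_mul, map_star]
    exact CStarRing.norm_mul_self_le _⟩
  have i7 : StarModule ℂ (Shrink.{0} D) := ⟨fun r x => f.injective (by
    change f _ = f _
    rw [map_star f, map_smul f, map_smul f, map_star f, star_smul])⟩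
  have i8 : CompleteSpace (Shrink.{0} D) :=
    (completeSpace_congr (e := e) hf.isUniformEmbedding).2 inferInstance
  exact ⟨Shrink.{0} D, { i4, i3, i6, i5, i7, i8 with }, ⟨f⟩⟩

/-- A C⋆-subalgebra generated by two elements has at most continuum many elements. -/
theorem small_topologicalClosure_adjoin.{u} {B : Type u} [CStarAlgebra B] (b c : B) :
    Small.{0} (StarAlgebra.adjoin ℂ {b, c}).topologicalClosure := by
  have h1 : Small.{0} (StarAlgebra.adjoin ℂ {b, c}) := by
    let f : Fin 4 → B := ![b, c, star b, star c]
    have : ((StarAlgebra.adjoin ℂ {b, c}) : Set B) ⊆ Set.range (FreeAlgebra.lift ℂ f) := by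
      intro x hx
      have hx' : x ∈ Algebra.adjoin ℂ ({b, c} ∪ star {b, c} : Set B) := hx
      have h3 : ({b, c} ∪ star {b, c} : Set B) ⊆ Set.range f := by
        rintro y ((rfl | rfl) | (hy | hy))
        · exact ⟨0, rfl⟩
        · exact ⟨1, rfl⟩
        · exact ⟨2, by simp [f, ← hy]⟩
        · exact ⟨3, by simp only [Set.mem_singleton_iff] at hy; simp [f, ← hy]⟩
      have h4 := Algebra.adjoin_mono h3 hx'
      rw [Algebra.adjoin_range_eq_range_freeAlgebra_lift] at h4
      exact h4
    exact small_subset this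
  have h2 : ∀ x : (StarAlgebra.adjoin ℂ {b, c}).topologicalClosure,
      ∃ s : ℕ → StarAlgebra.adjoin ℂ {b, c},
        Filter.Tendsto (fun n => (s n : B)) Filter.atTop (nhds x) := by
    intro x
    obtain ⟨s, hs, hx⟩ := mem_closure_iff_seq_limit.1 x.2
    exact ⟨fun n => ⟨s n, hs n⟩, hx⟩
  choose s hs using h2
  refine small_of_injective (f := s) fun x y hxy => Subtype.ext ?_
  exact tendsto_nhds_unique (hs x) (hxy ▸ hs y)

/-- A representation of the defining relations of `C(SU_q(2))` in a nonzero unital C⋆-algebra.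
A C⋆-algebra generated by two elements is separable, hence has at most the cardinality of the
continuum, so that the C⋆-algebras in `Type` suffice (`CSUq2.existsUnique_hom` below). -/
structure SUq2Rep (q : ℝ) : Type 1 where
  carrier : Type
  [cstar : CStarAlgebra carrier]
  [nontrivial : Nontrivial carrier]
  a : carrier
  c : carrier
  rel : SUq2Relations q a c

attribute [instance] SUq2Rep.cstar SUq2Rep.nontrivial

/-- The C⋆-algebra of all bounded families `(x_ρ)_ρ` indexed by the representations `ρ`, with the
pointwise operations and the norm `sup_ρ ‖x_ρ‖`. -/
abbrev SUq2Prod (q : ℝ) : Type 1 := lp (fun ρ : SUq2Rep q => ρ.carrier) ∞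

instance SUq2Prod.cstarAlgebra (q : ℝ) : CStarAlgebra (SUq2Prod q) where

/-- The family of all images of the generator `α`. -/
def SUq2Prod.alpha (q : ℝ) : SUq2Prod q :=
  ⟨fun ρ => ρ.a, memℓp_infty ⟨1, by rintro _ ⟨ρ, rfl⟩; exact ρ.rel.norm_left_le⟩⟩

/-- The family of all images of the generator `γ`. -/
def SUq2Prod.gamma (q : ℝ) : SUq2Prod q :=
  ⟨fun ρ => ρ.c, memℓp_infty ⟨1, by rintro _ ⟨ρ, rfl⟩; exact ρ.rel.norm_right_le⟩⟩

/-- The universal unital C⋆-algebra generated by elements `α`, `γ` subject to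
`SUq2Relations`: the C⋆-algebra generated by the two universal families, whose norm is the
supremum of the norms in all representations of the relations. -/
def SUq2Subalgebra (q : ℝ) : StarSubalgebra ℂ (SUq2Prod q) :=
  (StarAlgebra.adjoin ℂ {SUq2Prod.alpha q, SUq2Prod.gamma q}).topologicalClosure

/-- The C⋆-algebra `C(SU_q(2))` as a type. -/
def CSUq2 (q : ℝ) : Type 1 := SUq2Subalgebra q

instance CSUq2.cstarAlgebra (q : ℝ) : CStarAlgebra (CSUq2 q) :=
  StarSubalgebra.cstarAlgebra (SUq2Subalgebra q) (h_closed := StarSubalgebra.isClosed_topologicalClosure _)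

namespace CSUq2

/-- The generator `α` of `C(SU_q(2))`. -/
def α (q : ℝ) : CSUq2 q :=
  ⟨SUq2Prod.alpha q, StarSubalgebra.le_topologicalClosure _
    (StarAlgebra.subset_adjoin ℂ _ (Set.mem_insert _ _))⟩

/-- The generator `γ` of `C(SU_q(2))`. -/
def γ (q : ℝ) : CSUq2 q :=
  ⟨SUq2Prod.gamma q, StarSubalgebra.le_topologicalClosure _
    (StarAlgebra.subset_adjoin ℂ _ (Set.mem_insert_of_mem _ rfl))⟩

theorem relations (q : ℝ) : SUq2Relations q (α q) (γ q) where
  mul_comm_q := Subtype.ext (Subtype.ext (funext fun ρ => ρ.rel.mul_comm_q))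
  mul_star_comm_q := Subtype.ext (Subtype.ext (funext fun ρ => ρ.rel.mul_star_comm_q))
  normal := Subtype.ext (Subtype.ext (funext fun ρ => ρ.rel.normal))
  star_mul_add := Subtype.ext (Subtype.ext (funext fun ρ => ρ.rel.star_mul_add))
  mul_star_add := Subtype.ext (Subtype.ext (funext fun ρ => ρ.rel.mul_star_add))

/-- The representation of `C(SU_q(2))` given by a representation of the relations. -/
def eval {q : ℝ} (ρ : SUq2Rep q) : CSUq2 q →⋆ₐ[ℂ] ρ.carrier where
  toFun x := x.1.1 ρ
  map_one' := rfl
  map_mul' _ _ := rfl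
  map_zero' := rfl
  map_add' _ _ := rfl
  commutes' r := by
    rw [Algebra.algebraMap_eq_smul_one, Algebra.algebraMap_eq_smul_one]; rfl
  map_star' _ := rfl

/-- A ⋆-homomorphism on `C(SU_q(2))` is determined by its values on `α` and `γ`. -/
theorem hom_ext.{u} {q : ℝ} {B : Type u} [CStarAlgebra B] {φ ψ : CSUq2 q →⋆ₐ[ℂ] B}
    (h1 : φ (α q) = ψ (α q)) (h2 : φ (γ q) = ψ (γ q)) : φ = ψ := by
  have hφ : Continuous φ :=
    AddMonoidHomClass.continuous_of_bound φ 1 fun x => by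
      rw [one_mul]; exact NonUnitalStarAlgHom.norm_apply_le φ x
  have hψ : Continuous ψ :=
    AddMonoidHomClass.continuous_of_bound ψ 1 fun x => by
      rw [one_mul]; exact NonUnitalStarAlgHom.norm_apply_le ψ x
  refine StarAlgHom.ext_topologicalClosure (A := SUq2Prod q)
    (S := StarAlgebra.adjoin ℂ {SUq2Prod.alpha q, SUq2Prod.gamma q})
    (B := B) (φ := φ) (ψ := ψ) hφ hψ ?_
  apply StarAlgHom.ext_adjoin
  rintro ⟨x, hx⟩ (rfl | rfl)
  · exact h1
  · exact h2

/-- The universal property of `C(SU_q(2))`, for unital C⋆-algebras in every universe. -/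
theorem existsUnique_hom.{u} {q : ℝ} {B : Type u} [CStarAlgebra B] {b c : B}
    (h : SUq2Relations q b c) :
    ∃! φ : CSUq2 q →⋆ₐ[ℂ] B, φ (α q) = b ∧ φ (γ q) = c := by
  suffices ∃ φ : CSUq2 q →⋆ₐ[ℂ] B, φ (α q) = b ∧ φ (γ q) = c by
    obtain ⟨φ, hφ⟩ := this
    exact ⟨φ, hφ, fun ψ hψ => hom_ext (hψ.1.trans hφ.1.symm) (hψ.2.trans hφ.2.symm)⟩
  rcases subsingleton_or_nontrivial B with hB | hB
  · let φ : CSUq2 q →⋆ₐ[ℂ] B :=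
      { toFun := fun _ => 0
        map_one' := Subsingleton.elim _ _
        map_mul' := fun _ _ => Subsingleton.elim _ _
        map_zero' := Subsingleton.elim _ _
        map_add' := fun _ _ => Subsingleton.elim _ _
        commutes' := fun _ => Subsingleton.elim _ _
        map_star' := fun _ => Subsingleton.elim _ _ }
    exact ⟨φ, Subsingleton.elim _ _, Subsingleton.elim _ _⟩
  · let S := (StarAlgebra.adjoin ℂ {b, c}).topologicalClosure
    let iS : CStarAlgebra S :=
      StarSubalgebra.cstarAlgebra S (h_closed := StarSubalgebra.isClosed_topologicalClosure _)
    have hs : Small.{0} S := small_topologicalClosure_adjoin b c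
    obtain ⟨T, iT, ⟨f⟩⟩ := exists_starAlgEquiv_of_small S
    let b' : S := ⟨b, StarSubalgebra.le_topologicalClosure _
      (StarAlgebra.subset_adjoin ℂ _ (Set.mem_insert _ _))⟩
    let c' : S := ⟨c, StarSubalgebra.le_topologicalClosure _
      (StarAlgebra.subset_adjoin ℂ _ (Set.mem_insert_of_mem _ rfl))⟩
    have hS : SUq2Relations q b' c' :=
      ⟨Subtype.ext h.1, Subtype.ext h.2, Subtype.ext h.3, Subtype.ext h.4, Subtype.ext h.5⟩
    have hT : SUq2Relations q (f.symm b') (f.symm c') := by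
      constructor <;> simp only [← map_mul, ← map_star, ← map_smul, ← map_add]
      · rw [hS.1]
      · rw [hS.2]
      · rw [hS.3]
      · rw [hS.4, map_one]
      · rw [hS.5, map_one]
    have : Nontrivial T := f.symm.injective.nontrivial
    let ρ : SUq2Rep q := ⟨T, f.symm b', f.symm c', hT⟩
    refine ⟨(S.subtype.comp (f : T →⋆ₐ[ℂ] S)).comp (eval ρ), ?_, ?_⟩
    · change ((f (f.symm b') : S) : B) = b
      rw [f.apply_symm_apply]
    · change ((f (f.symm c') : S) : B) = c
      rw [f.apply_symm_apply]

/-- The fundamental representation `U` of `SU_q(2)`, a unitary `2 × 2` matrix over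
`C(SU_q(2))`. -/
def fundamental (q : ℝ) : UnitaryMatrix (CSUq2 q) 2 :=
  ⟨!![α q, -((q : ℂ) • star (γ q)); γ q, star (α q)], (relations q).matrix_mem_unitary⟩

/-- For `0 < q < 1` the element `αα⋆` of `C(SU_q(2))` is invertible. -/
theorem isUnit_alpha_mul_star {q : ℝ} (h0 : 0 < q) (h1 : q < 1) : IsUnit (α q * star (α q)) :=
  (relations q).isUnit_mul_star h0 h1

/-- Masuda's unitary `w̃ = 1 + (γ - 1)(1 - α⋆(αα⋆)⁻¹α)`. -/
def masuda {q : ℝ} (h0 : 0 < q) (h1 : q < 1) : unitary (CSUq2 q) :=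
  ⟨1 + (γ q - 1) * (1 - star (α q) * ↑(isUnit_alpha_mul_star h0 h1).unit⁻¹ * α q),
    (relations q).masuda_mem_unitary (isUnit_alpha_mul_star h0 h1).mul_val_inv⟩

end CSUq2

end

/-! ### Homotopy and stabilization in K₁ -/

section KOne

variable {A : Type*} [CStarAlgebra A]

/-! Since αα⋆ is invertible, α⋆ has a polar decomposition α⋆ = v|α⋆| with v an isometry, and p = 1 -
vv⋆ = 1 - α⋆(αα⋆)⁻¹α is the projection onto the kernel of α. There γ is unitary, because γ⋆γ = 1 -
α⋆α, and w̃ is γ on that kernel and 1 on the range of v.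

Damping the γ-entries of U by t, except on the kernel, and replacing |α⋆| by R_t = (1 -
t²q²γγ⋆)^(1/2) keeps the matrix unitary (`deformation_mem_unitary`); this rests on γv = qvγ and γ⋆v
= qvγ⋆. At t = 1 the matrix is U. At t = 0 it is diag(1, w̃)·V, where V has rows (v⋆, 0) and (p, v).

The factor V is trivial in K₁: for every isometry v, the Halmos dilations of tv⋆ join it to the same
quarter turn J (`joined_halmos`), and for v = 1 the endpoint V is the identity. Conjugation by J
turns diag(1, w̃) into diag(w̃, 1), so [U] = [w̃]. The condition 0 < q < 1 enters through the
invertibility of αα⋆. -/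

theorem UnitaryMatrix.joined_of_path {n : ℕ} {u v : UnitaryMatrix A n}
    (f : ℝ → Matrix (Fin n) (Fin n) A) (hf : ContinuousOn f (Set.Icc 0 1))
    (hmem : ∀ t ∈ Set.Icc (0 : ℝ) 1, f t ∈ unitary (Matrix (Fin n) (Fin n) A))
    (h0 : f 0 = u) (h1 : f 1 = v) : Joined u v :=
  ⟨{ toFun := fun t => ⟨f t, hmem t t.2⟩
     continuous_toFun := (continuousOn_iff_continuous_domRestrict.1 hf).subtype_mk _
     source' := Subtype.ext h0
     target' := Subtype.ext h1 }⟩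

theorem KOne.mk_mul {n : ℕ} (u v : UnitaryMatrix A n) :
    KOne.mk (u * v) = KOne.mk u * KOne.mk v := by
  rw [KOne.mk, ← DirectLimit.mul_def]
  rfl

theorem KOne.mk_eq_one_of_joined {n : ℕ} {u : UnitaryMatrix A n} (h : Joined 1 u) :
    KOne.mk u = 1 :=
  (QuotientGroup.eq_one_iff _).2 ⟨n, u, h, rfl⟩

theorem KOne.mk_eq_of_joined {n : ℕ} {u v : UnitaryMatrix A n} (h : Joined u v) :
    KOne.mk u = KOne.mk v := by
  have h1 : Joined 1 (u⁻¹ * v) := by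
    simpa using (Joined.refl u⁻¹).mul h
  have h2 := KOne.mk_mul u (u⁻¹ * v)
  rw [KOne.mk_eq_one_of_joined h1, mul_one, mul_inv_cancel_left] at h2
  exact h2.symm

theorem KOne.mk_pad {n m : ℕ} (h : n ≤ m) (u : UnitaryMatrix A n) :
    KOne.mk (UnitaryMatrix.pad n m h u) = KOne.mk u := by
  rw [KOne.mk, KOne.mk, DirectLimit.mk_apply]

end KOne

/-! ### Unitary dilations of an isometry -/

section Isometry

variable {A : Type*} [CStarAlgebra A]

/-- The Halmos dilation of the contraction `t v⋆`, for an isometry `v` and `t² + s² = 1`. -/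
theorem halmos_mem_unitary {v : A} (hv : star v * v = 1) {t s : ℝ} (hts : t ^ 2 + s ^ 2 = 1) :
    !![(t : ℂ) • star v, -((s : ℂ) • (1 : A)); 1 - (1 - (s : ℂ)) • (v * star v), (t : ℂ) • v] ∈
      unitary (Matrix (Fin 2) (Fin 2) A) := by
  have hv' : ∀ w, star v * (v * w) = w := fun w => by rw [← mul_assoc, hv, one_mul]
  have hts' : (t : ℂ) ^ 2 = 1 - (s : ℂ) ^ 2 := by
    rw [← Complex.ofReal_pow, eq_sub_of_add_eq hts]; push_cast; rfl
  constructor <;> ext i j <;> fin_cases i <;> fin_cases j <;>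
    simp [Matrix.mul_apply, Matrix.star_apply, Fin.sum_univ_two, mul_sub, sub_mul,
      mul_assoc, hv, hv', smul_sub, -Complex.coe_smul] <;>
    match_scalars <;>
    first | ring1 | linear_combination hts'

/-- The Halmos dilation with s = √(1 - t²) forgets v at t = 0. All isometries thus share one
starting point, and comparison with v = 1 makes every such dilation trivial in K₁. -/
theorem joined_halmos {v : A} (hv : star v * v = 1) {u w : UnitaryMatrix A 2}
    (hu : u.1 = !![0, -1; 1, 0]) (hw : w.1 = !![star v, 0; 1 - v * star v, v]) : Joined u w := by
  have hs : ∀ t ∈ Set.Icc (0 : ℝ) 1, t ^ 2 + √(1 - t ^ 2) ^ 2 = 1 := fun t ht => by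
    rw [Real.sq_sqrt (by nlinarith [ht.1, ht.2])]; ring
  refine UnitaryMatrix.joined_of_path
    (fun t => !![(t : ℂ) • star v, -(((√(1 - t ^ 2) : ℝ) : ℂ) • (1 : A));
      1 - (1 - ((√(1 - t ^ 2) : ℝ) : ℂ)) • (v * star v), (t : ℂ) • v]) ?_
    (fun t ht => halmos_mem_unitary hv (hs t ht)) ?_ ?_
  · refine Continuous.continuousOn (continuous_matrix fun i j => ?_)
    fin_cases i <;> fin_cases j <;> simp [-Complex.coe_smul] <;> fun_prop
  · rw [hu]; simp
  · rw [hw]; simp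

end Isometry

/-! ### Deforming the fundamental matrix -/

section Deformation

variable {A : Type*} [CStarAlgebra A]

/-- The unitarity of the matrix obtained from the fundamental one by scaling `c` by `t` on the
range of the isometry `v` in the polar decomposition of `a⋆`. -/
theorem deformation_mem_unitary {c v R : A} {q t : ℝ} (hR : star R = R)
    (hRR : R * R = 1 - ((t : ℂ) ^ 2 * (q : ℂ) ^ 2) • (c * star c))
    (hRc : R * c = c * R) (hRc' : R * star c = star c * R)
    (hcn : c * star c = star c * c) (hv : star v * v = 1)
    (hcv : c * v = (q : ℂ) • (v * c)) (hcv' : star c * v = (q : ℂ) • (v * star c))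
    (hp : c * star c * (1 - v * star v) = 1 - v * star v) :
    !![R * star v, -(((t : ℂ) * (q : ℂ)) • star c);
      c * (1 - (1 - (t : ℂ)) • (v * star v)), v * R] ∈ unitary (Matrix (Fin 2) (Fin 2) A) := by
  have assoc : ∀ {x y z : A}, x * y = z → ∀ w, x * (y * w) = z * w := fun h w => by
    rw [← mul_assoc, h]
  have hvc : star v * c = (q : ℂ) • (c * star v) := by
    simpa using congrArg star hcv'
  have hvc' : star v * star c = (q : ℂ) • (star c * star v) := by
    simpa using congrArg star hcv
  -- Moving cc⋆ past v costs q², and cc⋆ is 1 on the complement of the range of v. This makes the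
  -- t²-terms of vR²v⋆ cancel those of the scaled c.
  have hp' : (q : ℂ) ^ 2 • (v * (c * (star c * star v))) = c * star c - 1 + v * star v := by
    have h2 : c * star c * (v * star v) = (q : ℂ) ^ 2 • (v * (c * (star c * star v))) := by
      rw [mul_assoc, assoc hcv', smul_mul_assoc, mul_smul_comm, mul_assoc, assoc hcv,
        smul_mul_assoc, smul_smul, mul_assoc, ← pow_two]
    rw [mul_sub, mul_one, h2, sub_eq_iff_eq_add] at hp
    rw [hp]
    abel
  constructor <;> ext i j <;> fin_cases i <;> fin_cases j <;>
    simp [Matrix.mul_apply, Matrix.star_apply, Fin.sum_univ_two, mul_sub, sub_mul,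
      mul_assoc, hR, hRR, hRc, hRc', ← hcn, hvc, hvc', assoc hRR,
      assoc hRc, assoc hRc', assoc hcn.symm, assoc hv, assoc hcv, assoc hcv', smul_sub, -Complex.coe_smul]
  all_goals first | module | linear_combination (norm := module) (-1 : ℂ) • hp'

/-- A continuous path of square roots of `1 - t² q² c c⋆`. -/
theorem SUq2Relations.exists_sqrt_path {q : ℝ} {a c : A} (h : SUq2Relations q a c) :
    ∃ R : ℝ → A, ContinuousOn R (Set.Icc 0 1) ∧ R 0 = 1 ∧ ∀ t ∈ Set.Icc (0 : ℝ) 1,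
      star (R t) = R t ∧ R t * R t = 1 - ((t : ℂ) ^ 2 * (q : ℂ) ^ 2) • (c * star c) ∧
      R t * c = c * R t ∧ R t * star c = star c * R t := by
  let := CStarAlgebra.spectralOrder A
  have := CStarAlgebra.spectralOrderedRing A
  have hn := h.normal
  have hpos : ∀ t ∈ Set.Icc (0 : ℝ) 1,
      (0 : A) ≤ 1 - ((t : ℂ) ^ 2 * (q : ℂ) ^ 2) • (c * star c) := fun t ht => by
    -- Positivity comes from 1 = aa⋆ + q²cc⋆, which leaves aa⋆ + (1 - t²)q²cc⋆, a sum of two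
    -- elements of the form xx⋆.
    have h1 : (1 : A) - ((t : ℂ) ^ 2 * (q : ℂ) ^ 2) • (c * star c)
        = a * star a + ((√(1 - t ^ 2) * q : ℝ) : ℂ) • c * star (((√(1 - t ^ 2) * q : ℝ) : ℂ) • c) := by
      have h2 : (((√(1 - t ^ 2) : ℝ)) : ℂ) ^ 2 = 1 - (t : ℂ) ^ 2 := by
        rw [← Complex.ofReal_pow, Real.sq_sqrt (by nlinarith [ht.1, ht.2])]; push_cast; rfl
      rw [eq_sub_of_add_eq h.mul_star_add, star_smul, smul_mul_smul_comm, Complex.star_def,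
        Complex.conj_ofReal]
      match_scalars
      · ring
      · linear_combination -(q : ℂ) ^ 2 * h2
    rw [h1]
    exact add_nonneg (mul_star_self_nonneg a) (mul_star_self_nonneg _)
  refine ⟨fun t => CFC.sqrt (1 - ((t : ℂ) ^ 2 * (q : ℂ) ^ 2) • (c * star c)), ?_, ?_, ?_⟩
  · refine CFC.continuousOn_sqrt.comp (Continuous.continuousOn ?_) hpos
    fun_prop
  · simp [CFC.sqrt_one]
  · intro t ht
    have hc : Commute (1 - ((t : ℂ) ^ 2 * (q : ℂ) ^ 2) • (c * star c)) c := by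
      refine (Commute.one_left c).sub_left (Commute.smul_left ?_ _)
      rw [Commute, SemiconjBy, mul_assoc, hn]
    have hc' : Commute (1 - ((t : ℂ) ^ 2 * (q : ℂ) ^ 2) • (c * star c)) (star c) := by
      refine (Commute.one_left _).sub_left (Commute.smul_left ?_ _)
      rw [Commute, SemiconjBy, ← mul_assoc, hn]
    -- The square root, being a functional calculus, commutes with whatever commutes with its
    -- argument.
    exact ⟨(CFC.sqrt_nonneg _).star_eq, CFC.sqrt_mul_sqrt_self _ (hpos t ht),
      hc.cfcₙ_nnreal _, hc'.cfcₙ_nnreal _⟩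

/-- The fundamental matrix is joined to the product of `diag(1, w)` with the unitary dilation of
an isometry, and hence has the class of Masuda's unitary `w`. -/
theorem SUq2Relations.mk_eq_masuda {q : ℝ} {a c y : A} (h : SUq2Relations q a c)
    (hy : y * (a * star a) = 1) (hy' : a * star a * y = 1)
    {u : UnitaryMatrix A 2} {w : unitary A}
    (hu : u.1 = !![a, -((q : ℂ) • star c); c, star a])
    (hw : w.1 = 1 + (c - 1) * (1 - star a * y * a)) :
    KOne.mk u = KOne.mk (UnitaryMatrix.ofUnitary w) := by
  obtain ⟨R, hRcont, hR0, hR⟩ := h.exists_sqrt_path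
  obtain ⟨hs, hRR, hRc, hRc'⟩ := hR 1 ⟨zero_le_one, le_rfl⟩
  have haa : R 1 * R 1 = a * star a := by
    rw [hRR, eq_sub_of_add_eq h.mul_star_add]; simp
  -- R 1 = |a⋆|, so S = (aa⋆)⁻¹|a⋆| is its inverse and a⋆S is the isometric part of a⋆.
  obtain ⟨S, hS⟩ : ∃ S : A, S = y * R 1 := ⟨_, rfl⟩
  have hSR : S * R 1 = 1 := by rw [hS, mul_assoc, haa, hy]
  have hRS : R 1 * S = 1 := by
    have h1 : R 1 * (R 1 * y) = 1 := by rw [← mul_assoc, haa, hy']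
    have h2 : S = R 1 * y := left_inv_eq_right_inv hSR h1
    rw [h2, h1]
  have hSs : star S = S :=
    left_inv_eq_right_inv (a := R 1) (by simpa [hs] using congrArg star hRS) hRS
  have hSS : S * S = y := by
    refine left_inv_eq_right_inv (a := a * star a) ?_ hy'
    rw [← haa, mul_assoc, ← mul_assoc S (R 1), hSR, one_mul, hSR]
  have comm_S : ∀ x, R 1 * x = x * R 1 → S * x = x * S := fun x hx => by
    calc S * x = S * (x * R 1) * S := by rw [mul_assoc, mul_assoc x, hRS, mul_one]
      _ = x * S := by rw [← hx, ← mul_assoc, hSR, one_mul]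
  have hSc := comm_S c hRc
  have hSc' := comm_S _ hRc'
  obtain ⟨v, hv⟩ : ∃ v : A, v = star a * S := ⟨_, rfl⟩
  have hvs : star v = S * a := by rw [hv, star_mul, star_star, hSs]
  have hvv : star v * v = 1 := by
    rw [hvs, hv, ← mul_assoc, mul_assoc S, ← haa, ← mul_assoc, hSR, one_mul, hRS]
  have hvv' : v * star v = star a * y * a := by
    rw [hvs, hv, ← hSS]; simp only [mul_assoc]
  have hcv : c * v = (q : ℂ) • (v * c) := by
    have h1 : c * star a = (q : ℂ) • (star a * c) := by
      simpa using congrArg star h.mul_star_comm_q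
    rw [hv, ← mul_assoc, h1, smul_mul_assoc, mul_assoc, mul_assoc, hSc]
  have hcv' : star c * v = (q : ℂ) • (v * star c) := by
    have h1 : star c * star a = (q : ℂ) • (star a * star c) := by
      simpa using congrArg star h.mul_comm_q
    rw [hv, ← mul_assoc, h1, smul_mul_assoc, mul_assoc, mul_assoc, hSc']
  -- The projection 1 - vv⋆ is killed by a, and c⋆c = 1 - a⋆a.
  have hp : c * star c * (1 - v * star v) = 1 - v * star v := by
    have h1 : a * (1 - v * star v) = 0 := by
      rw [hvv', mul_sub, mul_one, ← mul_assoc, ← mul_assoc, hy', one_mul, sub_self]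
    rw [h.normal, eq_sub_of_add_eq' h.star_mul_add, sub_mul, one_mul, mul_assoc, h1, mul_zero,
      sub_zero]
  have hw' : w.1 = 1 + (c - 1) * (1 - v * star v) := by rw [hw, hvv']
  have hwv : w.1 * v = v := by
    rw [hw', add_mul, one_mul, mul_assoc, sub_mul 1, one_mul, mul_assoc, hvv, mul_one, sub_self,
      mul_zero, add_zero]
  have hwp : w.1 * (1 - v * star v) = c * (1 - v * star v) := by
    rw [mul_sub w.1, mul_one, ← mul_assoc, hwv, hw']; noncomm_ring
  let J : UnitaryMatrix A 2 := ⟨!![0, -1; 1, 0], by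
    constructor <;> ext i j <;> fin_cases i <;> fin_cases j <;>
      simp [Matrix.mul_apply, Matrix.star_apply]⟩
  let D : UnitaryMatrix A 2 := ⟨!![1, 0; 0, w.1], by
    constructor <;> ext i j <;> fin_cases i <;> fin_cases j <;>
      simp [Matrix.mul_apply, Matrix.star_apply]⟩
  let V : UnitaryMatrix A 2 := ⟨!![star v, 0; 1 - v * star v, v], by
    simpa using halmos_mem_unitary hvv (t := 1) (s := 0) (by norm_num)⟩
  -- With the isometry 1, the dilation path is a rotation from J to the identity.
  have hJ1 : KOne.mk J = 1 := KOne.mk_eq_one_of_joined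
    (joined_halmos (v := 1) (by simp) rfl (by ext i j; fin_cases i <;> fin_cases j <;> simp)).symm
  have hJV : KOne.mk J = KOne.mk V := KOne.mk_eq_of_joined (joined_halmos hvv rfl rfl)
  have hDV : KOne.mk (D * V) = KOne.mk u := by
    refine KOne.mk_eq_of_joined (UnitaryMatrix.joined_of_path
      (fun t => !![R t * star v, -(((t : ℂ) * (q : ℂ)) • star c);
        c * (1 - (1 - (t : ℂ)) • (v * star v)), v * R t]) ?_ (fun t ht => ?_) ?_ ?_)
    · refine continuousOn_pi.2 fun i => continuousOn_pi.2 fun j => ?_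
      fin_cases i <;> fin_cases j <;> simp [-Complex.coe_smul] <;> fun_prop
    · obtain ⟨e1, e2, e3, e4⟩ := hR t ht
      exact deformation_mem_unitary e1 e2 e3 e4 h.normal hvv hcv hcv' hp
    -- At t = 0 the lower row is (cp, v) with p = 1 - vv⋆, which is w(p, v) because wp = cp and wv =
    -- v.
    · change _ = D.1 * V.1
      ext i j
      fin_cases i <;> fin_cases j <;> simp [D, V, hR0, Matrix.mul_apply, hwv, hwp]
    · have e1 : R 1 * star v = a := by rw [hvs, ← mul_assoc, hRS, one_mul]
      have e2 : v * R 1 = star a := by rw [hv, mul_assoc, hSR, mul_one]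
      rw [hu]
      simp [e1, e2]
  -- The quarter turn exchanges the two diagonal places, bringing w to the corner used by
  -- stabilization.
  have hDJ : D * J = J * UnitaryMatrix.pad 1 2 one_le_two (UnitaryMatrix.ofUnitary w) := by
    refine Subtype.ext ?_
    change D.1 * J.1 = J.1 * padMatrix 1 2 (Matrix.of fun _ _ => w.1)
    ext i j
    fin_cases i <;> fin_cases j <;> simp [D, J, Matrix.mul_apply, padMatrix_apply]
  rw [← hDV, KOne.mk_mul, ← hJV, ← KOne.mk_mul, hDJ, KOne.mk_mul, hJ1, one_mul, KOne.mk_pad]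

end Deformation

theorem lemma5p1 (q : ℝ) (h0 : 0 < q) (h1 : q < 1) :
    KOne.mk (CSUq2.fundamental q) =
      KOne.mk (UnitaryMatrix.ofUnitary (CSUq2.masuda h0 h1)) :=
  (CSUq2.relations q).mk_eq_masuda (CSUq2.isUnit_alpha_mul_star h0 h1).val_inv_mul
    (CSUq2.isUnit_alpha_mul_star h0 h1).mul_val_inv rfl rfl
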